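/- For $p\in[0,1]$ let $\mathbb P_p$ be the product measure on $\Xi=\{0,1\}^{\mathbb N}$, $\mathbb N=\{1,2,\dots\}$, under which each digit equals $1$ with probability $p$. For $\xi\in\Xi$ let $\Gamma=\{i\in\mathbb N:\xi_i=1\}$. Fix an integer $M$ and group the points of $\Gamma$ into clusters as follows; each cluster $\mathcal C$ is a subset of $\Gamma$ with a start-point $\alpha(\mathcal C)$, an end-point $\omega(\mathcal C)$ and a mass $m(\mathcal C)\in\mathbb N$, and $d(\cdot,\cdot)$ denotes the Euclidean distance between sets. Level $0$: $\mathbf C_0=\mathbf C_{0,0}$ consists of the singletons $\{x\}$, $x\in\Gamma$, with mass $1$ and $\alpha=\omega=x$. Level $k+1$ ($k\ge 0$): let $\mathbf C_{k,k+1}=\{\mathcal C\in\mathbf C_k: m(\mathcal C)\ge k+1\}$. A maximal $(k+1)$-run is a finite sequence of $n\ge 2$ consecutive (in increasing order) clusters $\mathcal C_1,\dots,\mathcal C_n$ of $\mathbf C_{k,k+1}$ with $d(\mathcal C_i,\mathcal C_{i+1})<M^{k+1}$ for $1\le i<n$, such that the element of $\mathbf C_{k,k+1}$ immediately preceding $\mathcal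 C_1$ (if any) and the one immediately following $\mathcal C_n$ (if any) are at distance at least $M^{k+1}$ from $\mathcal C_1$ and $\mathcal C_n$, respectively. The span of the run is $[\alpha(\mathcal C_1),\omega(\mathcal C_n)]$. Each maximal $(k+1)$-run gives a cluster of level $k+1$, namely $[\alpha(\mathcal C_1),\omega(\mathcal C_n)]\cap\Gamma$, with start-point $\alpha(\mathcal C_1)$, end-point $\omega(\mathcal C_n)$ and mass $m(\mathcal C_1)+\sum_{i=2}^n (m(\mathcal C_i)-k)$. Let $\mathbf C_{k+1,k+1}$ be the set of clusters of level $k+1$, and let $\mathbf C_{k+1}$ be the union of $\mathbf C_{k+1,k+1}$ and of the set of those $\mathcal C\in\mathbf C_k$ that are disjoint from the spans of all maximal $(k+1)$-runs. For $x\in\Gamma$ put $\kappa(x)=\sup\{\ell\ge 0: x\in\mathcal C\text{ for some }\mathcal C\in\mathbf C_{\ell,\ell}\}\in\{0,1,2,\dots\}\cup\{\infty\}$. Lemma. Let $\xi$ be distributed according to $\mathbb P_p$, with $p>0$ and $3\le M<(64p)^{-1/2}$. Then almost surely $\kappa(x)<\infty$ for all $x\in\Gamma$. -/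

import Mathlib

open MeasureTheory ProbabilityTheory

noncomputable section

namespace KSVGrouping

/-- The space `{0,1}^ℕ` of binary sequences `ξ = (ξ₁, ξ₂, …)`, indexed by the positive integers. -/
abbrev BinSeq : Type := ℕ+ → Fin 2

/-- The product measure on `{0,1}^ℕ` under which every digit equals `1` with probability `p` and
`0` with probability `1 - p`. -/
def productBernoulli (p : unitInterval) : Measure BinSeq :=
  Measure.infinitePi fun _ : ℕ+ => bernoulliMeasure (1 : Fin 2) 0 p

/-- `Γ(ξ)`: the set of positions of the ones of `ξ`. -/
def ones (ξ : BinSeq) : Set ℕ := {n | ∃ i : ℕ+, (i : ℕ) = n ∧ ξ i = 1}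

/-- A cluster: its set of points together with its start-point `α`, its end-point `ω` and its
mass. -/
structure Cluster where
  carrier : Set ℕ
  startPt : ℕ
  endPt : ℕ
  mass : ℕ

/-- The cluster `{x}` of level `0`, of mass one and with `α = ω = x`. -/
def singletonCluster (x : ℕ) : Cluster where
  carrier := {x}
  startPt := x
  endPt := x
  mass := 1

/-- The distance between two (nonempty) sets of integers, `inf {|a - b| : a ∈ A, b ∈ B}`. -/
def setDist (A B : Set ℕ) : ℕ := sInf {n | ∃ a ∈ A, ∃ b ∈ B, n = Nat.dist a b}

/-- The distance between two clusters. -/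
def Cluster.dist (c d : Cluster) : ℕ := setDist c.carrier d.carrier

/-- `c` lies to the left of `d`. -/
def Cluster.Before (c d : Cluster) : Prop := c.endPt < d.startPt

/-- `c` and `d` are two consecutive elements, `c` on the left, of the collection `S`. -/
def Consecutive (S : Set Cluster) (c d : Cluster) : Prop :=
  c ∈ S ∧ d ∈ S ∧ c.Before d ∧ ∀ e ∈ S, ¬ (c.Before e ∧ e.Before d)

/-- The last cluster of the finite list `c, cs`. -/
def lastOf (c : Cluster) (cs : List Cluster) : Cluster := (c :: cs).getLast (List.cons_ne_nil c cs)

/-- The finite list `c, cs` is a maximal run, of length at least two, of consecutive elements of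
`S` whose successive distances are smaller than `R`: it has at least two terms, each term and the
next one are consecutive in `S` and at distance `< R`, while the element of `S` that immediately
precedes the first term (if there is one) and the element that immediately follows the last term
(if there is one) are at distance `≥ R` from that term. Runs are finite by definition; under the
product measures considered, infinite runs occur with probability zero. -/
def IsMaximalRun (S : Set Cluster) (R : ℕ) (c : Cluster) (cs : List Cluster) : Prop :=
  cs ≠ [] ∧
  List.IsChain (fun a b => Consecutive S a b ∧ a.dist b < R) (c :: cs) ∧
  (∀ a, Consecutive S a c → R ≤ a.dist c) ∧
  (∀ b, Consecutive S (lastOf c cs) b → R ≤ (lastOf c cs).dist b)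

/-- The span of the run `c, cs`: the interval from the start-point of its first constituent to the
end-point of its last constituent. -/
def runSpan (c : Cluster) (cs : List Cluster) : Set ℕ := Set.Icc c.startPt (lastOf c cs).endPt

/-- The cluster of level `k + 1` made from a `(k+1)`-run with constituents `c, cs`: all points of
`Γ` in the span of the run (so that it includes the dust between the constituents), with mass
`m(c) + ∑ (m(c') - k)`, summed over the constituents `c'` other than the first. Constituents of a
`(k+1)`-run have mass at least `k + 1`, so the subtraction never truncates. -/
def runCluster (Γ : Set ℕ) (k : ℕ) (c : Cluster) (cs : List Cluster) : Cluster where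
  carrier := runSpan c cs ∩ Γ
  startPt := c.startPt
  endPt := (lastOf c cs).endPt
  mass := c.mass + (cs.map fun d => d.mass - k).sum

/-- `C_{k,k+1}`: the clusters of the collection `P` that have mass at least `k + 1`. -/
def heavy (P : Set Cluster) (k : ℕ) : Set Cluster := {c ∈ P | k + 1 ≤ c.mass}

/-- `c, cs` is a maximal `(k+1)`-run of the collection `P` (the one called `C_k`). -/
def IsLevelRun (M k : ℕ) (P : Set Cluster) (c : Cluster) (cs : List Cluster) : Prop :=
  IsMaximalRun (heavy P k) (M ^ (k + 1)) c cs

/-- The clusters of level `k + 1` that are formed from the collection `P` (the one called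
`C_k`). -/
def newClusters (Γ : Set ℕ) (M k : ℕ) (P : Set Cluster) : Set Cluster :=
  {d | ∃ c cs, IsLevelRun M k P c cs ∧ d = runCluster Γ k c cs}

/-- The clusters of the collection `P` (the one called `C_k`) that are disjoint from the spans of
all maximal `(k+1)`-runs. -/
def survivors (M k : ℕ) (P : Set Cluster) : Set Cluster :=
  {d ∈ P | ∀ c cs, IsLevelRun M k P c cs → Disjoint d.carrier (runSpan c cs)}

/-- The partition `C_k` of `Γ` into clusters. For `k = 0` the recursive step is exactly the
formation of the level-1 clusters from the points of `Γ`: all singletons have mass `1`, the runs are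
runs of points with gaps `< M`, and the mass of a level-1 cluster is its cardinality. -/
def partition (Γ : Set ℕ) (M : ℕ) : ℕ → Set Cluster
  | 0 => singletonCluster '' Γ
  | k + 1 => newClusters Γ M k (partition Γ M k) ∪ survivors M k (partition Γ M k)

/-- `C_{ℓ,ℓ}`: the set of all clusters of level `ℓ`. -/
def levelClusters (Γ : Set ℕ) (M : ℕ) : ℕ → Set Cluster
  | 0 => singletonCluster '' Γ
  | k + 1 => newClusters Γ M k (partition Γ M k)

/-- `κ(x)`: the supremum, in `ℕ ∪ {∞}`, of the levels of the clusters that contain `x`. -/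
def kappa (Γ : Set ℕ) (M : ℕ) (x : ℕ) : ℕ∞ :=
  sSup {n | ∃ l : ℕ, n = (l : ℕ∞) ∧ ∃ c ∈ levelClusters Γ M l, x ∈ c.carrier}

end KSVGrouping

end

open scoped ENNReal

noncomputable section

namespace KSVGrouping

/-! The proof is a first-moment bound followed by Borel–Cantelli. A cluster is replaced by a
pattern: a finite set of ones, up to translation, that forces its mass; dust is dropped. A pattern
of n points and mass m occurs at a given place with probability at most p^n and receives the weight
p^n (8M)^m.

Adding a constituent to a (k+1)-run leaves at most M^(k+1) gaps to choose from and loses k units of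
mass. Joining thus multiplies total weights up to a factor M^(k+1) / (8M)^k = M / 8^k. The geometric
decay keeps the total weight of `family M k` below `bound k / M`, with `bound k` < 1/4
(`tsum_family_le`); the induction starts because 64 p M² ≤ 1.

Since M ≥ 3, a pattern of mass m in `family M k` has diameter at most 3(m - k)M^k
(`mem_family_bounds`), so at most 4 m M^k ≤ 4 · 4^(-k) (8M)^m starting places let it cover a given
x. The tilt (8M)^m pays for this entropy, and x lies in a level-k cluster with probability at most 4
· 4^(-k), which is summable in k. -/

/-- A translation-invariant blueprint of a cluster: its mass, and the list of successive gaps of a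
finite set of points of `Γ` that forces this mass. -/
@[ext]
structure Pattern where
  mass : ℕ
  gaps : List ℕ

/-! ### Patterns and their concatenation -/

namespace Pattern

/-- Concatenation of two patterns at distance `g`, with the mass of a two-term `(k+1)`-run. -/
def join (k : ℕ) (q : Pattern) (g : ℕ) (r : Pattern) : Pattern where
  mass := q.mass + r.mass - k
  gaps := q.gaps ++ g :: r.gaps

/-- All concatenations of patterns from `F` and `R` at a positive distance at most `N`. -/
def joins (k N : ℕ) (F R : Set Pattern) : Set Pattern :=
  Set.range fun x : F × R × Fin N => join k x.1 (x.2.2 + 1) x.2.1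

/-- Patterns of runs of at most `n + 1` constituents from `F`. -/
def chains (k N : ℕ) (F : Set Pattern) : ℕ → Set Pattern
  | 0 => F
  | n + 1 => F ∪ joins k N F (chains k N F n)

/-- Patterns of the clusters of mass at least `k + 1` of the collection `C_k`. -/
def family (M : ℕ) : ℕ → Set Pattern
  | 0 => {⟨1, []⟩}
  | k + 1 => {q ∈ ⋃ n, chains k (M ^ (k + 1)) (family M k) n | k + 2 ≤ q.mass}

/-- The probability of occurrence of a pattern at a given place, tilted by its mass. -/
def weight (p t : ℝ≥0∞) (q : Pattern) : ℝ≥0∞ := p ^ (q.gaps.length + 1) * t ^ q.mass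

/-- The points of a pattern with the given gaps, placed at `a`. -/
def trace (a : ℕ) : List ℕ → Finset ℕ
  | [] => {a}
  | g :: L => insert a (trace (a + g) L)

lemma le_of_mem_trace {a x : ℕ} {L : List ℕ} (h : x ∈ trace a L) : a ≤ x := by
  induction L generalizing a with
  | nil => simp [trace] at h; omega
  | cons g L ih =>
    simp only [trace, Finset.mem_insert] at h
    rcases h with rfl | h
    · exact le_rfl
    · have := ih h; omega

lemma card_trace (a : ℕ) {L : List ℕ} (h : ∀ g ∈ L, 0 < g) : (trace a L).card = L.length + 1 := by
  induction L generalizing a with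
  | nil => simp [trace]
  | cons g L ih =>
    have hg := h g (by simp)
    rw [trace, Finset.card_insert_of_notMem, ih _ fun x hx => h x (by simp [hx])]
    · simp
    · intro hx
      have := le_of_mem_trace hx
      omega

lemma trace_append_cons (a g : ℕ) (L L' : List ℕ) :
    trace a (L ++ g :: L') = trace a L ∪ trace (a + L.sum + g) L' := by
  induction L generalizing a with
  | nil => simp [trace]
  | cons b L ih => simp [trace, ih, add_assoc]

lemma chains_succ_subset (k N : ℕ) (F : Set Pattern) (n : ℕ) :
    chains k N F n ⊆ chains k N F (n + 1) := by
  induction n with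
  | zero => exact Set.subset_union_left
  | succ n ih =>
    refine Set.union_subset_union_right _ ?_
    rintro _ ⟨⟨q, r, g⟩, rfl⟩
    exact ⟨⟨q, ⟨r, ih r.2⟩, g⟩, rfl⟩

lemma chains_mono (k N : ℕ) (F : Set Pattern) : Monotone (chains k N F) :=
  monotone_nat_of_le_succ (chains_succ_subset k N F)

/-- Every finite partial sum already lives in a single `S n`. This lets a bound uniform in the
number of constituents pass to runs of any length. -/
lemma tsum_iUnion_le_of_monotone {α : Type*} {S : ℕ → Set α} (hS : Monotone S) (f : α → ℝ≥0∞)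
    {C : ℝ≥0∞} (h : ∀ n, ∑' x : S n, f x ≤ C) : ∑' x : ⋃ n, S n, f x ≤ C := by
  classical
  rw [ENNReal.tsum_eq_iSup_sum]
  refine iSup_le fun s => ?_
  obtain ⟨n, hn⟩ := hS.directed_le.exists_mem_subset_of_finset_subset_biUnion
    (s := s.map (Function.Embedding.subtype _)) (by
      intro x hx
      simp only [Finset.coe_map, Function.Embedding.subtype_apply, Set.mem_image] at hx
      obtain ⟨y, -, rfl⟩ := hx
      exact y.2)
  calc ∑ x ∈ s, f x = ∑ x ∈ s.map (Function.Embedding.subtype _), f x := by simp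
    _ = ∑' x : (↑(s.map (Function.Embedding.subtype _)) : Set α), f x :=
        (Finset.tsum_subtype' _ f).symm
    _ ≤ ∑' x : S n, f x := ENNReal.tsum_mono_subtype f hn
    _ ≤ C := h n

/-- Numbers of points add up, while masses add up to a loss of k; the factor `t ^ k` restores that
loss. -/
lemma weight_join (p t : ℝ≥0∞) (k g : ℕ) (q r : Pattern) (hk : k ≤ q.mass) :
    weight p t (join k q g r) * t ^ k = weight p t q * weight p t r := by
  have h : t ^ (q.mass + r.mass - k) * t ^ k = t ^ q.mass * t ^ r.mass := by
    rw [← pow_add, ← pow_add]; congr 1; omega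
  simp only [weight, join]
  rw [mul_assoc, h, List.length_append, List.length_cons]
  ring

/-- Only an inequality, since different triples may give the same pattern. The factor N counts the
gaps, on which the weight does not depend. -/
lemma tsum_joins_mul_le (p t : ℝ≥0∞) (k N : ℕ) (F R : Set Pattern)
    (hF : ∀ q ∈ F, k ≤ q.mass) :
    (∑' q : joins k N F R, weight p t q) * t ^ k ≤
      N * (∑' q : F, weight p t q) * ∑' q : R, weight p t q := by
  calc (∑' q : joins k N F R, weight p t q) * t ^ k
      ≤ (∑' x : F × R × Fin N, weight p t (join k x.1 (x.2.2 + 1) x.2.1)) * t ^ k := by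
        gcongr
        exact ENNReal.tsum_le_tsum_comp_of_surjective Set.rangeFactorization_surjective
          fun q : joins k N F R => weight p t q
    _ = ∑' x : F × R × Fin N, weight p t x.1 * weight p t x.2.1 := by
        rw [← ENNReal.tsum_mul_right]
        exact tsum_congr fun x => weight_join _ _ _ _ _ _ (hF _ x.1.2)
    _ = _ := by
        rw [ENNReal.tsum_prod']
        simp_rw [ENNReal.tsum_prod', tsum_fintype, Finset.sum_const, Finset.card_univ,
          Fintype.card_fin, nsmul_eq_mul, ENNReal.tsum_mul_left, ENNReal.tsum_mul_right]
        ring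

/-! ### Diameter of patterns -/

/-- Mass, gaps and diameter of the patterns of level at most `k`. -/
lemma mem_chains_bounds {M k : ℕ} {F : Set Pattern}
    (hF : ∀ q ∈ F, k + 1 ≤ q.mass ∧ (∀ g ∈ q.gaps, 0 < g) ∧
      q.gaps.sum ≤ 3 * (q.mass - k) * M ^ k) (n : ℕ) :
    ∀ q ∈ chains k (M ^ (k + 1)) F n, k + 1 ≤ q.mass ∧ (∀ g ∈ q.gaps, 0 < g) ∧
      q.gaps.sum ≤ 3 * (q.mass - k) * M ^ k + (q.mass - k - 1) * M ^ (k + 1) := by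
  have base : ∀ q ∈ F, k + 1 ≤ q.mass ∧ (∀ g ∈ q.gaps, 0 < g) ∧
      q.gaps.sum ≤ 3 * (q.mass - k) * M ^ k + (q.mass - k - 1) * M ^ (k + 1) := fun q hq =>
    ⟨(hF q hq).1, (hF q hq).2.1, (hF q hq).2.2.trans (Nat.le_add_right _ _)⟩
  induction n with
  | zero => exact base
  | succ n ih =>
    rintro q (hq | ⟨⟨⟨q, hq⟩, ⟨r, hr⟩, g⟩, rfl⟩)
    · exact base q hq
    obtain ⟨hq1, hq2, hq3⟩ := hF q hq
    obtain ⟨hr1, hr2, hr3⟩ := ih r hr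
    refine ⟨by simp only [join]; omega, ?_, ?_⟩
    · intro x hx
      simp only [join, List.mem_append, List.mem_cons] at hx
      rcases hx with hx | rfl | hx
      exacts [hq2 x hx, Nat.succ_pos _, hr2 x hx]
    · have hg : (g : ℕ) + 1 ≤ M ^ (k + 1) := g.2
      obtain ⟨a, ha⟩ := Nat.exists_eq_add_of_le hq1
      obtain ⟨b, hb⟩ := Nat.exists_eq_add_of_le hr1
      simp only [join, List.sum_append, List.sum_cons]
      have e1 : q.mass - k = a + 1 := by omega
      have e2 : r.mass - k = b + 1 := by omega
      have e3 : q.mass + r.mass - k - k = a + b + 2 := by omega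
      rw [e1] at hq3
      rw [e2, Nat.add_sub_cancel] at hr3
      rw [e3, show a + b + 2 - 1 = a + (b + 1) by omega, add_mul a]
      nlinarith [Nat.zero_le (a * M ^ (k + 1))]

lemma mem_family_bounds {M : ℕ} (hM : 3 ≤ M) (k : ℕ) :
    ∀ q ∈ family M k, k + 1 ≤ q.mass ∧ (∀ g ∈ q.gaps, 0 < g) ∧
      q.gaps.sum ≤ 3 * (q.mass - k) * M ^ k := by
  induction k with
  | zero => rintro q rfl; simp
  | succ k ih =>
    rintro q ⟨hq, hm⟩
    obtain ⟨n, hn⟩ := Set.mem_iUnion.1 hq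
    obtain ⟨h1, h2, h3⟩ := mem_chains_bounds ih n q hn
    refine ⟨hm, h2, h3.trans ?_⟩
    obtain ⟨b, hb⟩ := Nat.exists_eq_add_of_le hm
    have e1 : q.mass - k = b + 2 := by omega
    have e2 : q.mass - (k + 1) = b + 1 := by omega
    -- With mass k + 2 + b, it remains to see 3(b + 2) ≤ 2(b + 1)M, which M ≥ 3 ensures.
    rw [e1, e2, show b + 2 - 1 = b + 1 by omega, pow_succ]
    have := Nat.mul_le_mul_left (2 * (b + 1) * M ^ k) hM
    nlinarith [Nat.zero_le (b * M ^ k)]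

/-! ### Total weight of the families -/

/-- The bounds on the total weight of the families of patterns, multiplied by `M`. -/
def bound (k : ℕ) : ℝ := 1 / 4 - (1 / 8) ^ k / 8

lemma bound_nonneg (k : ℕ) : 0 ≤ bound k := by
  have : (1 / 8 : ℝ) ^ k ≤ 1 := pow_le_one₀ (by norm_num) (by norm_num)
  unfold bound; linarith

/-- With e = (1/8)^k, the increment of `bound` is 7e/64, while the product of two values of `bound`
is at most 1/16 = 4/64. -/
lemma bound_step (k : ℕ) :
    bound k + (1 / 8) ^ k * (bound k * bound (k + 1)) ≤ bound (k + 1) := by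
  have h0 : (0 : ℝ) < (1 / 8) ^ k := by positivity
  have h1 : (1 / 8 : ℝ) ^ k ≤ 1 := pow_le_one₀ (by norm_num) (by norm_num)
  unfold bound
  rw [pow_succ]
  generalize (1 / 8 : ℝ) ^ k = e at *
  nlinarith [mul_nonneg h0.le (sub_nonneg.2 h1), mul_pos h0 h0, mul_pos (mul_pos h0 h0) h0]

lemma tsum_joins_le {M : ℕ} (hM : 0 < M) (p : ℝ≥0∞) (k : ℕ) (F R : Set Pattern)
    (hF : ∀ q ∈ F, k ≤ q.mass) {a b : ℝ} (ha : 0 ≤ a)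
    (hFa : ∑' q : F, weight p (8 * M) q ≤ ENNReal.ofReal (a / M))
    (hRb : ∑' q : R, weight p (8 * M) q ≤ ENNReal.ofReal (b / M)) :
    ∑' q : joins k (M ^ (k + 1)) F R, weight p (8 * M) q ≤
      ENNReal.ofReal ((1 / 8) ^ k * (a * b) / M) := by
  have hM' : (0 : ℝ) < M := by exact_mod_cast hM
  have h := tsum_joins_mul_le p (8 * M) k (M ^ (k + 1)) F R hF
  have ht : ((8 : ℝ≥0∞) * M) ^ k = ENNReal.ofReal ((8 * M) ^ k) := by
    rw [ENNReal.ofReal_pow (by positivity), ENNReal.ofReal_mul (by norm_num)]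
    simp
  have ht0 : (0 : ℝ) < (8 * M) ^ k := by positivity
  have hN : ((M ^ (k + 1) : ℕ) : ℝ≥0∞) = ENNReal.ofReal (M ^ (k + 1)) := by
    rw [ENNReal.ofReal_pow (by positivity)]; simp
  rw [ht] at h
  rw [← ENNReal.le_div_iff_mul_le (Or.inl (ENNReal.ofReal_pos.2 ht0).ne') (Or.inl ENNReal.ofReal_ne_top)] at h
  refine h.trans ?_
  calc _ ≤ ENNReal.ofReal (M ^ (k + 1)) * ENNReal.ofReal (a / M) * ENNReal.ofReal (b / M) /
          ENNReal.ofReal ((8 * M) ^ k) := by rw [hN]; gcongr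
    _ = ENNReal.ofReal (M ^ (k + 1) * (a / M) * (b / M) / (8 * M) ^ k) := by
        rw [ENNReal.ofReal_div_of_pos ht0, ENNReal.ofReal_mul (by positivity),
          ENNReal.ofReal_mul (by positivity)]
    _ ≤ _ := by
        apply ENNReal.ofReal_le_ofReal
        apply le_of_eq
        rw [mul_pow, one_div, inv_pow]
        field_simp
        ring

lemma tsum_family_le {M : ℕ} (hM : 3 ≤ M) {p : ℝ} (hp : 0 ≤ p) (hpM : 64 * p * M ^ 2 ≤ 1) (k : ℕ) :
    ∑' q : family M k, weight (ENNReal.ofReal p) (8 * M) q ≤ ENNReal.ofReal (bound k / M) := by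
  have hM0 : 0 < M := by omega
  have hM' : (0 : ℝ) < M := by exact_mod_cast hM0
  induction k with
  | zero =>
    have h8 : ((8 : ℝ≥0∞) * M) = ENNReal.ofReal (8 * M) := by
      rw [ENNReal.ofReal_mul (by norm_num)]; simp
    rw [family, tsum_singleton (⟨1, []⟩ : Pattern) (weight _ _), weight, List.length_nil, zero_add,
      pow_one, pow_one, h8, ← ENNReal.ofReal_mul hp]
    apply ENNReal.ofReal_le_ofReal
    -- A single point has weight 8pM, and 8pM ≤ (1/8)/M is exactly 64 p M² ≤ 1.
    rw [le_div_iff₀ hM', bound]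
    norm_num
    nlinarith
  | succ k ih =>
    refine (ENNReal.tsum_mono_subtype _ (Set.sep_subset _ _)).trans
      (tsum_iUnion_le_of_monotone (chains_mono _ _ _) _ fun n => ?_)
    have hmono : bound k ≤ bound (k + 1) := by
      have := bound_step k
      have := mul_nonneg (bound_nonneg k) (bound_nonneg (k + 1))
      have : (0 : ℝ) ≤ (1 / 8) ^ k * (bound k * bound (k + 1)) := by positivity
      linarith
    -- The bound for k + 1 is stable under adding one more constituent in front, by `bound_step`,
    -- hence holds for all lengths n.
    induction n with
    | zero => exact ih.trans (ENNReal.ofReal_le_ofReal (by gcongr))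
    | succ n ihn =>
      refine (ENNReal.tsum_union_le _ _ _).trans ((add_le_add ih (tsum_joins_le hM0 _ k _ _
        (fun q hq => (Nat.le_succ k).trans (mem_family_bounds hM k q hq).1) (bound_nonneg k)
        ih ihn)).trans ?_)
      have := mul_nonneg (bound_nonneg k) (bound_nonneg (k + 1))
      rw [← ENNReal.ofReal_add (div_nonneg (bound_nonneg k) hM'.le) (by positivity), ← add_div]
      apply ENNReal.ofReal_le_ofReal
      have := bound_step k
      gcongr

end Pattern

/-! ### From clusters to patterns -/

/-- A cluster is well formed if its start-point and end-point are its extreme points, and it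
consists of points of `Γ`. -/
structure Cluster.WellFormed (Γ : Set ℕ) (c : Cluster) : Prop where
  start_mem : c.startPt ∈ c.carrier
  end_mem : c.endPt ∈ c.carrier
  subset : c.carrier ⊆ Γ
  subset_Icc : c.carrier ⊆ Set.Icc c.startPt c.endPt

lemma Cluster.WellFormed.start_le_end {Γ : Set ℕ} {c : Cluster} (h : c.WellFormed Γ) :
    c.startPt ≤ c.endPt := (h.subset_Icc h.start_mem).2

lemma Cluster.WellFormed.gap_le_dist {Γ : Set ℕ} {c d : Cluster} (hc : c.WellFormed Γ)
    (hd : d.WellFormed Γ) (h : c.Before d) : d.startPt - c.endPt ≤ c.dist d := by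
  unfold Cluster.Before at h
  refine le_csInf ⟨_, _, hc.end_mem, _, hd.start_mem, rfl⟩ ?_
  rintro n ⟨a, ha, b, hb, rfl⟩
  have h1 := (hc.subset_Icc ha).2
  have h2 := (hd.subset_Icc hb).1
  unfold Nat.dist
  omega

@[simp]
lemma lastOf_nil (c : Cluster) : lastOf c [] = c := rfl

@[simp]
lemma lastOf_cons (c d : Cluster) (ds : List Cluster) : lastOf c (d :: ds) = lastOf d ds := by
  simp [lastOf]

/-- The points of the pattern `q`, placed at `a`, belong to `Γ` and end at `b`, and `q` has
mass `m`. -/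
def Realizes (Γ : Set ℕ) (q : Pattern) (a b m : ℕ) : Prop :=
  q.mass = m ∧ b = a + q.gaps.sum ∧ ↑(Pattern.trace a q.gaps) ⊆ Γ

/-- Peel off the first constituent: the gap from its end-point to the next start-point is at most
the distance, hence below N, and the patterns are joined at that gap. The length bound records that
each further constituent adds at least one unit of mass. -/
lemma chain_spec {Γ : Set ℕ} {P : Set Cluster} {k N : ℕ} {F : Set Pattern}
    (hP : ∀ c ∈ P, c.WellFormed Γ)
    (hF : ∀ c ∈ heavy P k, ∃ q ∈ F, Realizes Γ q c.startPt c.endPt c.mass)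
    (c : Cluster) (cs : List Cluster) (hc : c ∈ heavy P k)
    (h : List.IsChain (fun a b => Consecutive (heavy P k) a b ∧ a.dist b < N) (c :: cs)) :
    c.startPt ≤ (lastOf c cs).endPt ∧ (lastOf c cs).WellFormed Γ ∧
    (cs.length ≤ (cs.map fun d => d.mass - k).sum) ∧
    ∃ n, ∃ q ∈ Pattern.chains k N F n, Realizes Γ q c.startPt (lastOf c cs).endPt
      (c.mass + (cs.map fun d => d.mass - k).sum) := by
  induction cs generalizing c with
  | nil =>
    obtain ⟨q, hq, hr⟩ := hF c hc
    exact ⟨(hP c hc.1).start_le_end, hP c hc.1, le_rfl, 0, q, hq, by simpa using hr⟩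
  | cons d ds ih =>
    obtain ⟨⟨⟨-, hd, hcd, -⟩, hdist⟩, htail⟩ := List.isChain_cons_cons.1 h
    obtain ⟨h1, h2, h3, n, r, hr, hrm, hre, hrt⟩ := ih d hd htail
    obtain ⟨q, hq, hqm, hqe, hqt⟩ := hF c hc
    have hgap := ((hP c hc.1).gap_le_dist (hP d hd.1) hcd).trans_lt hdist
    have hcse := (hP c hc.1).start_le_end
    have hdm : k + 1 ≤ d.mass := hd.2
    have hcm : k + 1 ≤ c.mass := hc.2
    unfold Cluster.Before at hcd
    rw [lastOf_cons, List.map_cons, List.sum_cons, List.length_cons]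
    refine ⟨by omega, h2, by omega, n + 1, Pattern.join k q (d.startPt - c.endPt) r, Or.inr ?_, ?_,
      ?_, ?_⟩
    -- `joins` shifts the index in `Fin N` by one to make gaps positive.
    · refine ⟨⟨⟨q, hq⟩, ⟨r, hr⟩, ⟨d.startPt - c.endPt - 1, by omega⟩⟩, ?_⟩
      show Pattern.join k q (d.startPt - c.endPt - 1 + 1) r = _
      congr 1
      omega
    · simp only [Pattern.join]
      omega
    · simp only [Pattern.join, List.sum_append, List.sum_cons]
      omega
    · simp only [Pattern.join]
      rw [Pattern.trace_append_cons, Finset.coe_union, ← hqe,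
        show c.endPt + (d.startPt - c.endPt) = d.startPt by omega]
      exact Set.union_subset hqt hrt

/-- A level-(k+1) cluster has mass at least k + 2 because its run has a first term of mass at least
k + 1 and at least one more term. So the heavy clusters, the only ones with patterns in the family,
include all clusters of the current level. -/
lemma partition_spec (Γ : Set ℕ) (M k : ℕ) :
    (∀ c ∈ partition Γ M k, c.WellFormed Γ) ∧
    (∀ c ∈ levelClusters Γ M k, c ∈ heavy (partition Γ M k) k) ∧
    ∀ c ∈ heavy (partition Γ M k) k,
      ∃ q ∈ Pattern.family M k, Realizes Γ q c.startPt c.endPt c.mass := by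
  induction k with
  | zero =>
    refine ⟨?_, ?_, ?_⟩
    · rintro _ ⟨x, hx, rfl⟩
      constructor <;> simp [singletonCluster, hx]
    · rintro _ ⟨x, hx, rfl⟩
      exact ⟨⟨x, hx, rfl⟩, by simp [singletonCluster]⟩
    · rintro _ ⟨⟨x, hx, rfl⟩, -⟩
      exact ⟨⟨1, []⟩, rfl, rfl, by simp [singletonCluster],
        by simpa [singletonCluster, Pattern.trace] using hx⟩
  | succ k ih =>
    obtain ⟨hP, -, hF⟩ := ih
    have head : ∀ {c cs}, IsLevelRun M k (partition Γ M k) c cs →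
        c ∈ heavy (partition Γ M k) k := by
      rintro c (- | ⟨d, ds⟩) h
      · exact absurd rfl h.1
      · exact (List.isChain_cons_cons.1 h.2.1).1.1.1
    have mass : ∀ {c cs}, IsLevelRun M k (partition Γ M k) c cs →
        k + 2 ≤ (runCluster Γ k c cs).mass := by
      intro c cs h
      have h1 := (chain_spec hP hF c cs (head h) h.2.1).2.2.1
      have h2 := List.length_pos_iff.2 h.1
      have h3 : k + 1 ≤ c.mass := (head h).2
      simp only [runCluster]
      omega
    refine ⟨?_, ?_, ?_⟩
    · rintro _ (⟨c, cs, h, rfl⟩ | h)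
      · obtain ⟨h1, h2, -⟩ := chain_spec hP hF c cs (head h) h.2.1
        have hc := hP c (head h).1
        exact ⟨⟨⟨le_rfl, h1⟩, hc.subset hc.start_mem⟩, ⟨⟨h1, le_rfl⟩, h2.subset h2.end_mem⟩,
          Set.inter_subset_right, Set.inter_subset_left⟩
      · exact hP _ h.1
    · rintro _ ⟨c, cs, h, rfl⟩
      exact ⟨Or.inl ⟨c, cs, h, rfl⟩, mass h⟩
    · rintro _ ⟨⟨c, cs, h, rfl⟩ | h, hm⟩
      · obtain ⟨-, -, -, n, q, hq, hr⟩ := chain_spec hP hF c cs (head h) h.2.1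
        exact ⟨q, ⟨Set.mem_iUnion.2 ⟨n, hq⟩, hr.1 ▸ hm⟩, hr⟩
      · obtain ⟨q, hq, hr⟩ := hF _ ⟨h.1, (Nat.le_succ _).trans hm⟩
        -- A survivor keeps its old pattern, viewed as a chain with no join.
        exact ⟨q, ⟨Set.mem_iUnion.2 ⟨0, hq⟩, hr.1 ▸ hm⟩, hr⟩

/-! ### Probability estimates -/

lemma productBernoulli_subset_ones_le (p : unitInterval) (s : Finset ℕ) :
    productBernoulli p {ξ | ↑s ⊆ ones ξ} ≤ ENNReal.ofReal p ^ s.card := by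
  classical
  by_cases h0 : 0 ∈ s
  -- Positions start at 1. The point 0 does arise, since starting places below are cut off at 0 by
  -- truncated subtraction.
  · have : {ξ | ↑s ⊆ ones ξ} = ∅ := by
      ext ξ
      simp only [Set.mem_ofPred_eq, Set.mem_empty_iff_false, iff_false]
      intro h
      obtain ⟨i, hi, -⟩ := h h0
      exact i.ne_zero hi
    simp [this]
  · have hs : ∀ n ∈ s, 0 < n := fun n hn => Nat.pos_of_ne_zero fun h => h0 (h ▸ hn)
    let s' : Finset ℕ+ := s.attach.image fun n : s => (⟨n.1, hs n.1 n.2⟩ : ℕ+)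
    have hcard : s'.card = s.card := by
      refine (Finset.card_image_of_injective _ fun a b hab => ?_).trans Finset.card_attach
      exact Subtype.ext (congrArg PNat.val hab)
    have hsub : {ξ : BinSeq | ↑s ⊆ ones ξ} ⊆ Set.pi s' fun _ => {1} := by
      intro ξ hξ i hi
      obtain ⟨n, -, rfl⟩ := Finset.mem_image.1 (Finset.mem_coe.1 hi)
      obtain ⟨j, hj, hj1⟩ := hξ n.2
      have : (⟨n, hs n.1 n.2⟩ : ℕ+) = j := PNat.eq hj.symm
      simpa [this] using hj1
    refine (measure_mono hsub).trans ?_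
    rw [productBernoulli, Measure.infinitePi_pi _ fun _ _ => MeasurableSet.singleton _,
      Finset.prod_const, hcard]
    gcongr
    rw [bernoulliMeasure_apply_of_mem_of_notMem _ (MeasurableSet.singleton _) (by simp) (by simp)]
    rw [ENNReal.ofReal]
    apply le_of_eq
    congr 1
    ext
    simp [p.2.1]

/-- The event that `x` belongs to a cluster of level `k` is exponentially unlikely. -/
lemma productBernoulli_level_le (p : unitInterval) {M : ℕ} (hM : 3 ≤ M)
    (hpM : 64 * (p : ℝ) * M ^ 2 ≤ 1) (x k : ℕ) :
    productBernoulli p {ξ | ∃ c ∈ levelClusters (ones ξ) M k, x ∈ c.carrier} ≤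
      4 * (1 / 4) ^ k := by
  have : Countable Pattern :=
    Function.Injective.countable (f := fun q : Pattern => (q.mass, q.gaps)) fun q r h =>
      Pattern.ext (congrArg Prod.fst h) (congrArg Prod.snd h)
  have hsub : {ξ | ∃ c ∈ levelClusters (ones ξ) M k, x ∈ c.carrier} ⊆
      ⋃ q : Pattern.family M k, ⋃ a ∈ Finset.Icc (x - q.1.gaps.sum) x,
        {ξ | ↑(Pattern.trace a q.1.gaps) ⊆ ones ξ} := by
    rintro ξ ⟨c, hc, hx⟩
    obtain ⟨h1, h2, h3⟩ := partition_spec (ones ξ) M k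
    have hc' := h2 c hc
    obtain ⟨q, hq, -, he, ht⟩ := h3 c hc'
    have hxI := (h1 c hc'.1).subset_Icc hx
    simp only [Set.mem_iUnion]
    refine ⟨⟨q, hq⟩, c.startPt, Finset.mem_Icc.2 ⟨?_, hxI.1⟩, ht⟩
    have := hxI.2
    simp only
    omega
  have hq : ∀ q ∈ Pattern.family M k,
      productBernoulli p (⋃ a ∈ Finset.Icc (x - q.gaps.sum) x,
        {ξ | ↑(Pattern.trace a q.gaps) ⊆ ones ξ}) ≤
      4 * (1 / 4) ^ k * Pattern.weight (ENNReal.ofReal p) (8 * M) q := by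
    intro q hq
    obtain ⟨h1, h2, h3⟩ := Pattern.mem_family_bounds hM k q hq
    have hcard : (Finset.Icc (x - q.gaps.sum) x).card ≤ 4 * (q.mass * M ^ k) := by
      have hM1 : 1 ≤ M ^ k := Nat.one_le_pow _ _ (by omega)
      have h4 : 3 * (q.mass - k) * M ^ k ≤ 3 * q.mass * M ^ k := by gcongr; omega
      have h5 : 1 ≤ q.mass * M ^ k := Nat.mul_pos (by omega) hM1
      rw [Nat.card_Icc]
      rw [mul_assoc] at h4
      have : x + 1 - (x - q.gaps.sum) ≤ q.gaps.sum + 1 := by omega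
      nlinarith
    -- The origin of the tilt: 8M = 2 · M · 4, where 2^m absorbs the mass, M^m the diameter scale
    -- and 4^m leaves the decay 4^(-k), as k ≤ m.
    have hpow : q.mass * M ^ k * 4 ^ k ≤ (8 * M) ^ q.mass := by
      have e1 : q.mass ≤ 2 ^ q.mass := Nat.lt_two_pow_self.le
      have e2 : M ^ k ≤ M ^ q.mass := Nat.pow_le_pow_right (by omega) (by omega)
      have e3 : 4 ^ k ≤ 4 ^ q.mass := Nat.pow_le_pow_right (by omega) (by omega)
      calc q.mass * M ^ k * 4 ^ k ≤ 2 ^ q.mass * M ^ q.mass * 4 ^ q.mass := by gcongr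
        _ = (8 * M) ^ q.mass := by rw [← mul_pow, ← mul_pow]; congr 1; ring
    have hpow' : ((q.mass * M ^ k : ℕ) : ℝ≥0∞) ≤ (1 / 4) ^ k * (8 * M) ^ q.mass := by
      have h4 : (1 / 4 : ℝ≥0∞) ^ k * 4 ^ k = 1 := by
        rw [← mul_pow, ENNReal.div_mul_cancel (by norm_num) (by norm_num), one_pow]
      calc ((q.mass * M ^ k : ℕ) : ℝ≥0∞)
          = (1 / 4) ^ k * ((q.mass * M ^ k * 4 ^ k : ℕ) : ℝ≥0∞) := by
            rw [Nat.cast_mul _ (4 ^ k), mul_left_comm, Nat.cast_pow 4, Nat.cast_ofNat, h4, mul_one]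
        _ ≤ (1 / 4) ^ k * (((8 * M) ^ q.mass : ℕ) : ℝ≥0∞) := by gcongr
        _ = _ := by push_cast; rfl
    calc _ ≤ ∑ a ∈ Finset.Icc (x - q.gaps.sum) x,
          productBernoulli p {ξ | ↑(Pattern.trace a q.gaps) ⊆ ones ξ} :=
          measure_biUnion_finset_le _ _
      _ ≤ ∑ a ∈ Finset.Icc (x - q.gaps.sum) x, ENNReal.ofReal p ^ (q.gaps.length + 1) := by
          gcongr with a
          rw [← Pattern.card_trace a h2]
          exact productBernoulli_subset_ones_le p _
      _ = (Finset.Icc (x - q.gaps.sum) x).card * ENNReal.ofReal p ^ (q.gaps.length + 1) := by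
          rw [Finset.sum_const, nsmul_eq_mul]
      _ ≤ ((4 * (q.mass * M ^ k) : ℕ) : ℝ≥0∞) * ENNReal.ofReal p ^ (q.gaps.length + 1) := by
          gcongr
      _ ≤ 4 * ((1 / 4) ^ k * (8 * M) ^ q.mass) * ENNReal.ofReal p ^ (q.gaps.length + 1) := by
          rw [Nat.cast_mul]
          gcongr
          norm_num
      _ = _ := by rw [Pattern.weight]; ring
  calc _ ≤ ∑' q : Pattern.family M k, productBernoulli p
        (⋃ a ∈ Finset.Icc (x - q.1.gaps.sum) x, {ξ | ↑(Pattern.trace a q.1.gaps) ⊆ ones ξ}) :=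
        (measure_mono hsub).trans (measure_iUnion_le _)
    _ ≤ ∑' q : Pattern.family M k,
          4 * (1 / 4) ^ k * Pattern.weight (ENNReal.ofReal p) (8 * M) q :=
        ENNReal.tsum_le_tsum fun q => hq q q.2
    _ ≤ 4 * (1 / 4) ^ k * 1 := by
        rw [ENNReal.tsum_mul_left]
        gcongr
        refine (Pattern.tsum_family_le hM p.2.1 hpM k).trans ?_
        rw [ENNReal.ofReal_le_one]
        have hM1 : (3 : ℝ) ≤ M := by exact_mod_cast hM
        rw [div_le_one (by linarith)]
        have : (0 : ℝ) < (1 / 8) ^ k := by positivity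
        unfold Pattern.bound
        linarith
    _ = _ := mul_one _

end KSVGrouping

end

theorem mainTheorem7 (p : unitInterval) (M : ℕ) (hp : 0 < (p : ℝ)) (hM : 3 ≤ M)
    (hMp : (M : ℝ) < (64 * (p : ℝ)) ^ (-(1 / 2) : ℝ)) :
    ∀ᵐ ξ ∂(KSVGrouping.productBernoulli p), ∀ x ∈ KSVGrouping.ones ξ,
      KSVGrouping.kappa (KSVGrouping.ones ξ) M x < ⊤ := by
  have hpM : 64 * (p : ℝ) * M ^ 2 ≤ 1 := by
    have h64 : (0 : ℝ) < 64 * p := by positivity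
    have h1 : (M : ℝ) ^ 2 ≤ ((64 * (p : ℝ)) ^ (-(1 / 2) : ℝ)) ^ 2 := by gcongr
    rw [← Real.rpow_natCast (_ ^ _), ← Real.rpow_mul h64.le] at h1
    norm_num [Real.rpow_neg_one] at h1
    calc 64 * (p : ℝ) * M ^ 2 ≤ 64 * p * ((p : ℝ)⁻¹ * (1 / 64)) := by gcongr
      _ = 1 := by field_simp
  have key : ∀ x : ℕ, ∀ᵐ ξ ∂(KSVGrouping.productBernoulli p), ∀ᶠ k in Filter.atTop,
      ξ ∉ {ξ | ∃ c ∈ KSVGrouping.levelClusters (KSVGrouping.ones ξ) M k, x ∈ c.carrier} := by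
    intro x
    -- Borel–Cantelli needs only summable outer measures, so measurability of these events is not
    -- required.
    refine ae_eventually_notMem (ne_top_of_le_ne_top ?_
      (ENNReal.tsum_le_tsum fun k => KSVGrouping.productBernoulli_level_le p hM hpM x k))
    rw [ENNReal.tsum_mul_left, ENNReal.tsum_geometric]
    refine ENNReal.mul_ne_top (by norm_num) (ENNReal.inv_ne_top.2 ?_)
    rw [ne_eq, tsub_eq_zero_iff_le, not_le, one_div]
    exact ENNReal.inv_lt_one.2 (by norm_num)
  filter_upwards [ae_all_iff.2 key] with ξ hξ x _
  obtain ⟨K, hK⟩ := Filter.eventually_atTop.1 (hξ x)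
  refine lt_of_le_of_lt (sSup_le ?_) (ENat.natCast_lt_top K)
  rintro _ ⟨l, rfl, hl⟩
  by_contra! hlt
  exact hK l (by exact_mod_cast hlt.le) hl
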